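/- **Conventions.** In a complete lattice $L$ an element $k$ is compact if $k\le\bigvee S$ implies $k\le\bigvee T$ for some finite $T\subseteq S$; $K(L)$ is the set of compact elements. An algebraic frame is a frame in which every element is a join of compact elements. We write $a\ll b$ if $b\le\bigvee S$ implies $a\le\bigvee T$ for some finite $T\subseteq S$. An element $p\neq 1$ is prime if $a\wedge b\le p$ implies $a\le p$ or $b\le p$, and pseudoprime if $a_1\wedge\dots\wedge a_n\ll p$ implies $a_i\le p$ for some $i$; $P(L)$ and $PP(L)$ are the sets of prime and of pseudoprime elements, and $Y_L=PP(L)\cup\{1\}$. **Frames.** $\mathsf{AlgFrm_J}$ is the category of algebraic frames and maps preserving arbitrary joins and compact elements. $\mathsf{AlgFrm_S}$ is its wide subcategory of those $\alpha:L\to M$ such that $\alpha(\bigwedge S)=\bigwedge\alpha[S]$ whenever $S\subseteq K(L)$ is finite and nonempty and $\bigwedge S\in K(L)$. **Spaces.** For a Priestley space $X$ and $X_0\subseteq X$, a clopen upset $U$ is admissible if all maximal elements of $X\setminus U$ lie in $X_0$; $\mathcal A(X)$ is the set of admissible clopen upsets and $\mathcal I_x=\{U\in\mathcal A(X): x\notin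 U\}$. A pointed generalized Priestley space is a tuple $(X,\tau,\le,X_0,m)$ such that $(X,\tau,\le)$ is a Priestley space, $m$ is its greatest element, $X_0\subseteq X\setminus\{m\}$ is dense in $X\setminus\{m\}$, every $x\ne m$ is below some $y\in X_0$, $x\in X_0$ iff $\mathcal I_x$ is nonempty and directed, and $x\le y$ iff every $U\in\mathcal A(X)$ that contains $x$ contains $y$. For $R\subseteq X\times Y$ put $\Box_RU=\{x: R[x]\subseteq U\}$. A generalized Priestley morphism $X\to Y$ is a relation $R\subseteq X\times Y$ such that (1) if $x\not\mathrel{R}y$, there is $U\in\mathcal A(Y)$ with $R[x]\subseteq U$ and $y\notin U$, and (2) $\Box_RU\in\mathcal A(X)$ for all $U\in\mathcal A(Y)$. These form the category $\mathsf{PGPS}$, where identities are the orders and $x\,(S*R)\,z$ iff every $U\in\mathcal A(Z)$ with $x\in\Box_R\Box_SU$ contains $z$. $\mathsf{PGPS_F}$ is the wide subcategory of functional morphisms: those for which every $R[x]$ has a least element. $\mathsf{PGPS_S}$ has the same objects; its morphisms are the strong Priestley morphisms, i.e. the order-preserving maps $f:X\to Y$ with $f^{-1}(U)\in\mathcal A(X)$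 for all $U\in\mathcal A(Y)$, with ordinary composition. A functional $R$ yields the strong Priestley morphism $x\mapsto\min R[x]$, and a strong Priestley morphism $f$ yields the functional morphism $R_f$, $x\,R_f\,y$ iff $f(x)\le y$. **Functors.** $\mathcal V^a:\mathsf{PGPS}^{op}\to\mathsf{AlgFrm_J}$ sends $X$ to the frame $\mathcal V^a(X)$, ordered by $\supseteq$, of closed upsets $C$ with $X\setminus C={\downarrow}(X_0\setminus C)$, and $R$ to $\Box_R$. $\mathcal Y:\mathsf{AlgFrm_J}\to\mathsf{PGPS}^{op}$ sends $L$ to $Y_L$ with distinguished subset $P(L)$, point $1$, the order of $L$, and the restriction of the topology on $L$ generated by the sets ${\uparrow}k$ and $({\uparrow}k)^c$, $k\in K(L)$; it sends $\alpha:L\to M$ with right adjoint $r$ to $R_\alpha\subseteq Y_M\times Y_L$, $p\,R_\alpha\,q$ iff $r(p)\le q$. **Theorem.** (a) $\mathcal Y$ and $\mathcal V^a$ form a dual equivalence between $\mathsf{AlgFrm_J}$ and $\mathsf{PGPS}$, with natural isomorphisms $\eta:1\to\mathcal V^a\mathcal Y$, $\eta_L(a)={\uparrow}a\cap Y_L$,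 and $\Upsilon:1\to\mathcal Y\mathcal V^a$, $x\,\Upsilon_X\,C$ iff $C\subseteq{\uparrow}x$. (b) This duality restricts to a duality between $\mathsf{AlgFrm_S}$ and $\mathsf{PGPS_F}$: $\mathcal Y$ sends $\mathsf{AlgFrm_S}$-morphisms to functional morphisms, $\mathcal V^a$ sends functional morphisms to $\mathsf{AlgFrm_S}$-morphisms, and $\eta$, $\Upsilon$ restrict to natural isomorphisms for the restricted functors. (c) Replacing functional morphisms by the corresponding strong Priestley morphisms yields a duality between $\mathsf{AlgFrm_S}$ and $\mathsf{PGPS_S}$, with natural isomorphisms $\eta$ and $x\mapsto{\uparrow}x$; its functors send an $\mathsf{AlgFrm_S}$-morphism $\alpha:L\to M$ to the restriction $r:Y_M\to Y_L$ of its right adjoint, and a strong Priestley morphism $f$ to $f^{-1}:\mathcal V^a(Y)\to\mathcal V^a(X)$. -/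

import Mathlib

open CategoryTheory Opposite

universe u

namespace GenPriestley

/-! ### Pointed generalized Priestley spaces -/

/-- `□_R U = {x | R[x] ⊆ U}`. -/
def box {X Y : Type u} (R : X → Y → Prop) (U : Set Y) : Set X := {x | ∀ y, R x y → y ∈ U}

/-- A clopen upset `U` of an ordered space is admissible, with respect to a set `X₀` of points, if
every maximal element of its complement lies in `X₀`. -/
def AdmissibleClopen {X : Type u} [TopologicalSpace X] [PartialOrder X] (X₀ U : Set X) : Prop :=
  IsClopen U ∧ IsUpperSet U ∧ ∀ x, Maximal (fun z => z ∈ Uᶜ) x → x ∈ X₀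

/-- The set `𝓘ₓ` of all admissible clopen upsets that miss `x`. -/
def missing {X : Type u} [TopologicalSpace X] [PartialOrder X] (X₀ : Set X) (x : X) :
    Set (Set X) := {U | AdmissibleClopen X₀ U ∧ x ∉ U}

/-- Pointed generalized Priestley spaces: a Priestley space with a greatest element `m` and a subset
`X₀` that is dense and order-dense in `X \ {m}`, such that `X₀` consists of the points `x` for which
`𝓘ₓ` is nonempty and directed, and such that the admissible clopen upsets determine the order. -/
structure PGPS : Type (u + 1) where
  carrier : Type u
  [topology : TopologicalSpace carrier]
  [order : PartialOrder carrier]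
  [compact : CompactSpace carrier]
  [priestley : PriestleySpace carrier]
  X₀ : Set carrier
  m : carrier
  le_m : ∀ x, x ≤ m
  X₀_subset : X₀ ⊆ {m}ᶜ
  dense : {m}ᶜ ⊆ closure X₀
  order_dense : ∀ x, x ≠ m → ∃ y ∈ X₀, x ≤ y
  mem_X₀_iff : ∀ x, x ∈ X₀ ↔
    (missing X₀ x).Nonempty ∧ DirectedOn (fun U V => U ⊆ V) (missing X₀ x)
  le_iff : ∀ x y, x ≤ y ↔ ∀ U, AdmissibleClopen X₀ U → x ∈ U → y ∈ U

instance : CoeSort PGPS.{u} (Type u) := ⟨PGPS.carrier⟩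

attribute [instance] PGPS.topology PGPS.order PGPS.compact PGPS.priestley

/-- The admissible clopen upsets of a pointed generalized Priestley space. -/
def PGPS.Adm (X : PGPS.{u}) (U : Set X) : Prop := AdmissibleClopen X.X₀ U

/-- Generalized Priestley morphisms: relations `R ⊆ X × Y` such that (1) if not `x R y`, then some
admissible clopen upset of `Y` contains `R[x]` and misses `y`, and (2) `□_R` sends admissible clopen
upsets of `Y` to admissible clopen upsets of `X`. -/
@[ext]
structure GPMor (X Y : PGPS.{u}) where
  rel : X → Y → Prop
  separates : ∀ x y, ¬ rel x y → ∃ U, Y.Adm U ∧ (∀ z, rel x z → z ∈ U) ∧ y ∉ U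
  box_adm : ∀ U, Y.Adm U → X.Adm (box rel U)

theorem PGPS.box_le (X : PGPS.{u}) {U : Set X} (hU : IsUpperSet U) :
    box (fun x y : X => x ≤ y) U = U := by
  ext x
  exact ⟨fun h => h x le_rfl, fun h y hy => hU hy h⟩

/-- The identity morphism is the order. -/
def GPMor.id (X : PGPS.{u}) : GPMor X X where
  rel x y := x ≤ y
  separates x y h := by
    rw [X.le_iff] at h
    push Not at h
    obtain ⟨U, hU, hx, hy⟩ := h
    exact ⟨U, hU, fun z hz => hU.2.1 hz hx, hy⟩
  box_adm U hU := by rw [X.box_le hU.2.1]; exact hU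

/-- The relation `S * R`: `x (S * R) z` iff every admissible clopen upset `U` of `Z` with
`x ∈ □_R □_S U` contains `z`. -/
def starRel {X Y Z : PGPS.{u}} (R : X → Y → Prop) (S : Y → Z → Prop) (x : X) (z : Z) : Prop :=
  ∀ U : Set Z, Z.Adm U → x ∈ box R (box S U) → z ∈ U

theorem box_starRel {X Y Z : PGPS.{u}} (R : X → Y → Prop) (S : Y → Z → Prop) {U : Set Z}
    (hU : Z.Adm U) : box (starRel R S) U = box R (box S U) := by
  ext x
  constructor
  · intro h y hxy t hyt
    exact h t fun W _ hx => hx y hxy t hyt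
  · intro h z hz
    exact hz U hU h

/-- The composition `S * R` of generalized Priestley morphisms (first `R`, then `S`). -/
def GPMor.comp {X Y Z : PGPS.{u}} (R : GPMor X Y) (S : GPMor Y Z) : GPMor X Z where
  rel := starRel R.rel S.rel
  separates x z h := by
    unfold starRel at h
    push Not at h
    obtain ⟨U, hU, hx, hz⟩ := h
    exact ⟨U, hU, fun t ht => ht U hU hx, hz⟩
  box_adm U hU := by
    rw [box_starRel _ _ hU]
    exact R.box_adm _ (S.box_adm _ hU)

/-- A generalized Priestley morphism is determined by `□` on admissible clopen upsets. -/
theorem GPMor.rel_iff {X Y : PGPS.{u}} (R : GPMor X Y) (x : X) (y : Y) :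
    R.rel x y ↔ ∀ U, Y.Adm U → x ∈ box R.rel U → y ∈ U := by
  constructor
  · intro h U _ hx
    exact hx y h
  · intro h
    by_contra hn
    obtain ⟨U, hU, h1, h2⟩ := R.separates x y hn
    exact h2 (h U hU h1)

theorem GPMor.ext_box {X Y : PGPS.{u}} {R S : GPMor X Y}
    (h : ∀ U, Y.Adm U → box R.rel U = box S.rel U) : R = S := by
  apply GPMor.ext
  funext x y
  rw [R.rel_iff, S.rel_iff]
  refine propext ⟨fun H U hU hx => H U hU (by rwa [h U hU]), fun H U hU hx => H U hU ?_⟩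
  rwa [← h U hU]

theorem GPMor.box_comp {X Y Z : PGPS.{u}} (R : GPMor X Y) (S : GPMor Y Z) {U : Set Z}
    (hU : Z.Adm U) : box (R.comp S).rel U = box R.rel (box S.rel U) :=
  box_starRel _ _ hU

/-- `PGPS` with generalized Priestley morphisms. -/
instance : Category PGPS.{u} where
  Hom := GPMor
  id := GPMor.id
  comp R S := R.comp S
  id_comp {X Y} R := GPMor.ext_box fun U hU => by
    rw [GPMor.box_comp _ _ hU]
    exact X.box_le (R.box_adm U hU).2.1
  comp_id {X Y} R := GPMor.ext_box fun U hU => by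
    rw [GPMor.box_comp _ _ hU]
    exact congrArg _ (Y.box_le hU.2.1)
  assoc R S T := GPMor.ext_box fun U hU => by
    rw [GPMor.box_comp _ _ hU, GPMor.box_comp _ _ (T.box_adm U hU), GPMor.box_comp _ _ hU,
      GPMor.box_comp _ _ hU]

/-- `R` is functional if every `R[x]` has a least element. -/
def functional : MorphismProperty PGPS.{u} :=
  fun _ _ R => ∀ x, ∃ y, IsLeast {z | GPMor.rel R x z} y

/-- The least element of `R[x]` for a functional `R`. -/
noncomputable def leastFun {X Y : PGPS.{u}} (R : X ⟶ Y) (h : functional R) (x : X) : Y :=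
  (h x).choose

theorem rel_iff_leastFun_le {X Y : PGPS.{u}} (R : X ⟶ Y) (h : functional R) (x : X) (y : Y) :
    GPMor.rel R x y ↔ leastFun R h x ≤ y := by
  have hl := (h x).choose_spec
  refine ⟨fun hy => hl.2 hy, fun hy => ?_⟩
  rw [GPMor.rel_iff]
  intro U hU hx
  exact hU.2.1 hy (hx _ hl.1)

theorem leastFun_eq {X Y : PGPS.{u}} (R : X ⟶ Y) (h : functional R) (x : X) (y : Y)
    (hy : ∀ z, GPMor.rel R x z ↔ y ≤ z) : leastFun R h x = y := by
  apply le_antisymm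
  · rw [← rel_iff_leastFun_le, hy]
  · rw [← hy, rel_iff_leastFun_le R h]

theorem box_leastFun {X Y : PGPS.{u}} (R : X ⟶ Y) (h : functional R) {U : Set Y}
    (hU : IsUpperSet U) : box (GPMor.rel R) U = leastFun R h ⁻¹' U := by
  ext x
  constructor
  · intro hx
    exact hx _ ((rel_iff_leastFun_le R h _ _).2 le_rfl)
  · intro hx y hy
    exact hU ((rel_iff_leastFun_le R h _ _).1 hy) hx

theorem comp_rel_iff {X Y Z : PGPS.{u}} (R : X ⟶ Y) (S : Y ⟶ Z) (hR : functional R)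
    (hS : functional S) (x : X) (z : Z) :
    GPMor.rel (R ≫ S) x z ↔ leastFun S hS (leastFun R hR x) ≤ z := by
  rw [Z.le_iff]
  refine forall₂_congr fun U hU => ?_
  rw [box_leastFun R hR (S.box_adm U hU).2.1, box_leastFun S hS hU.2.1]
  rfl

instance : functional.{u}.IsMultiplicative where
  id_mem _ := fun x => ⟨x, le_rfl, fun _ hz => hz⟩
  comp_mem R S hR hS := fun x => ⟨leastFun S hS (leastFun R hR x),
    (comp_rel_iff R S hR hS x _).2 le_rfl, fun z hz => (comp_rel_iff R S hR hS x z).1 hz⟩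

/-- The wide subcategory of `PGPS` of functional morphisms. -/
abbrev PGPSF : Type (u + 1) := WideSubcategory functional.{u}

/-- Pointed generalized Priestley spaces, as objects of the category with strong Priestley
morphisms. -/
structure PGPSS : Type (u + 1) where
  toPGPS : PGPS.{u}

/-- Strong Priestley morphisms: order-preserving maps that pull admissible clopen upsets back to
admissible clopen upsets. -/
@[ext]
structure StrongMor (X Y : PGPS.{u}) where
  toFun : X → Y
  monotone : Monotone toFun
  preimage_adm : ∀ U, Y.Adm U → X.Adm (toFun ⁻¹' U)

instance : Category PGPSS.{u} where
  Hom X Y := StrongMor X.toPGPS Y.toPGPS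
  id X := ⟨fun x => x, monotone_id, fun _ h => h⟩
  comp f g := ⟨fun x => g.toFun (f.toFun x), g.monotone.comp f.monotone,
    fun U hU => f.preimage_adm _ (g.preimage_adm U hU)⟩

/-- The functor `PGPS_F ⥤ PGPS_S`, `R ↦ (x ↦ min R[x])`. -/
noncomputable def toStrong : PGPSF.{u} ⥤ PGPSS.{u} where
  obj X := ⟨X.obj⟩
  map {X Y} R :=
    { toFun := leastFun R.hom R.property
      monotone := by
        intro x x' hx
        rw [Y.obj.le_iff]
        intro U hU h
        have h1 := box_leastFun R.hom R.property hU.2.1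
        have h2 := (GPMor.box_adm R.hom U hU).2.1
        rw [h1] at h2
        exact h2 hx h
      preimage_adm := by
        intro U hU
        rw [← box_leastFun R.hom R.property hU.2.1]
        exact GPMor.box_adm R.hom U hU }
  map_id X := StrongMor.ext (funext fun x => leastFun_eq _ _ _ _ fun _ => Iff.rfl)
  map_comp {X Y Z} R S := StrongMor.ext (funext fun x => leastFun_eq _ _ _ _
    fun z => comp_rel_iff R.hom S.hom R.property S.property x z)

theorem box_of_fun {X Y : PGPS.{u}} (f : X → Y) {U : Set Y} (hU : IsUpperSet U) :
    box (fun x y => f x ≤ y) U = f ⁻¹' U := by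
  ext x
  exact ⟨fun h => h _ le_rfl, fun h y hy => hU hy h⟩

/-- The functor `PGPS_S ⥤ PGPS_F`, `f ↦ R_f` with `x R_f y` iff `f x ≤ y`. -/
def ofStrong : PGPSS.{u} ⥤ PGPSF.{u} where
  obj X := ⟨X.toPGPS⟩
  map {X Y} f :=
    { hom :=
        { rel := fun x y => f.toFun x ≤ y
          separates := by
            intro x y h
            rw [Y.toPGPS.le_iff] at h
            push Not at h
            obtain ⟨U, hU, hx, hy⟩ := h
            exact ⟨U, hU, fun z hz => hU.2.1 hz hx, hy⟩
          box_adm := by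
            intro U hU
            rw [box_of_fun _ hU.2.1]
            exact f.preimage_adm U hU }
      property := fun x => ⟨f.toFun x, le_rfl, fun _ hz => hz⟩ }
  map_id X := rfl
  map_comp {X Y Z} f g := by
    apply WideSubcategory.hom_ext
    refine GPMor.ext_box fun U hU => ?_
    refine Eq.trans ?_ (GPMor.box_comp _ _ hU).symm
    have h1 := box_of_fun g.toFun hU.2.1
    have h2 := box_of_fun f.toFun (Y := Y.toPGPS) (g.preimage_adm U hU).2.1
    have h3 := box_of_fun (fun x => g.toFun (f.toFun x)) hU.2.1
    refine h3.trans ?_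
    change _ = box (fun x y => f.toFun x ≤ y) (box (fun x y => g.toFun x ≤ y) U)
    rw [h1, h2]
    rfl

/-! ### Algebraic frames -/

/-- Algebraic frames. -/
structure AlgFrmJ : Type (u + 1) where
  carrier : Type u
  [frame : Order.Frame carrier]
  [algebraic : IsCompactlyGenerated carrier]

instance : CoeSort AlgFrmJ.{u} (Type u) := ⟨AlgFrmJ.carrier⟩

attribute [instance] AlgFrmJ.frame AlgFrmJ.algebraic

/-- Maps between algebraic frames that preserve arbitrary joins and compact elements. -/
@[ext]
structure JMor (L M : AlgFrmJ.{u}) where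
  toFun : L → M
  map_sSup : ∀ S : Set L, toFun (sSup S) = sSup (toFun '' S)
  map_compact : ∀ k : L, IsCompactElement k → IsCompactElement (toFun k)

instance : Category AlgFrmJ.{u} where
  Hom := JMor
  id L := ⟨fun a => a, fun S => by simp, fun _ h => h⟩
  comp f g := ⟨fun a => g.toFun (f.toFun a),
    fun S => by rw [f.map_sSup, g.map_sSup, Set.image_image],
    fun k hk => g.map_compact _ (f.map_compact k hk)⟩

/-- Preservation of those nonempty finite meets of compact elements that are compact. -/
def preservesCompactMeets : MorphismProperty AlgFrmJ.{u} :=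
  fun L _ α => ∀ S : Set L, S.Finite → S.Nonempty → (∀ k ∈ S, IsCompactElement k) →
    IsCompactElement (sInf S) → JMor.toFun α (sInf S) = sInf (JMor.toFun α '' S)

instance : preservesCompactMeets.{u}.IsMultiplicative where
  id_mem L := fun S _ _ _ _ => by
    change sInf S = sInf ((fun a => a) '' S)
    simp
  comp_mem α β hα hβ := fun S hS hne hk hI => by
    change β.toFun (α.toFun (sInf S)) = sInf ((fun a => β.toFun (α.toFun a)) '' S)
    have h := hα S hS hne hk hI
    rw [h, hβ _ (hS.image _) (hne.image _), Set.image_image]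
    · rintro _ ⟨k, hkS, rfl⟩
      exact α.map_compact k (hk k hkS)
    · rw [← h]
      exact α.map_compact _ hI

/-- The wide subcategory of `AlgFrmJ` of morphisms that preserve those nonempty finite meets of
compact elements that are compact. -/
abbrev AlgFrmS : Type (u + 1) := WideSubcategory preservesCompactMeets.{u}

theorem JMor.monotone {L M : AlgFrmJ.{u}} (α : JMor L M) : Monotone α.toFun := by
  intro a b hab
  have h := α.map_sSup {a, b}
  rw [sSup_pair, sup_eq_right.2 hab, Set.image_pair, sSup_pair] at h
  rw [h]
  exact le_sup_left

/-- The right adjoint of a join-preserving map. -/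
def JMor.rightAdjoint {L M : AlgFrmJ.{u}} (α : JMor L M) (b : M) : L := sSup {a | α.toFun a ≤ b}

theorem JMor.gc {L M : AlgFrmJ.{u}} (α : JMor L M) :
    GaloisConnection α.toFun α.rightAdjoint := by
  intro a b
  constructor
  · intro h
    exact le_sSup h
  · intro h
    refine (α.monotone h).trans ?_
    unfold JMor.rightAdjoint
    rw [α.map_sSup]
    apply sSup_le
    rintro _ ⟨c, hc, rfl⟩
    exact hc

theorem compact_iff {L : Type u} [CompleteLattice L] (k : L) : IsCompactElement k ↔
    ∀ S : Set L, k ≤ sSup S → ∃ T ⊆ S, T.Finite ∧ k ≤ sSup T := by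
  rw [CompleteLattice.isCompactElement_iff_exists_le_sSup_of_le_sSup]
  refine forall₂_congr fun S _ => ?_
  constructor
  · rintro ⟨t, ht, hk⟩
    exact ⟨t, ht, t.finite_toSet, by rwa [← Finset.sup_id_eq_sSup]⟩
  · rintro ⟨T, hT, hf, hk⟩
    refine ⟨hf.toFinset, by simpa using hT, ?_⟩
    rw [Finset.sup_id_eq_sSup]
    simpa using hk

theorem compact_sSup {L : Type u} [CompleteLattice L] {T : Set L} (hT : T.Finite)
    (h : ∀ k ∈ T, IsCompactElement k) : IsCompactElement (sSup T) := by
  have h1 := CompleteLattice.isCompactElement_finsetSup (f := id) hT.toFinset (by simpa using h)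
  rw [Finset.sup_id_eq_sSup] at h1
  simpa using h1

theorem exists_compact {L : Type u} [CompleteLattice L] [IsCompactlyGenerated L] {a b : L}
    (h : ¬ a ≤ b) : ∃ k, IsCompactElement k ∧ k ≤ a ∧ ¬ k ≤ b := by
  rw [le_iff_compact_le_imp] at h
  push Not at h
  exact h

/-! ### Admissible closed upsets -/

/-- In a compact Priestley space, every point of a closed set is below a maximal one. -/
theorem exists_maximal {X : Type u} [TopologicalSpace X] [PartialOrder X] [CompactSpace X]
    [PriestleySpace X] {C : Set X} (hC : IsClosed C) {x : X} (hx : x ∈ C) :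
    ∃ y, x ≤ y ∧ Maximal (fun z => z ∈ C) y := by
  have hIci : ∀ a : X, IsClosed (Set.Ici a) := by
    intro a
    rw [← isOpen_compl_iff, isOpen_iff_forall_mem_open]
    intro b hb
    obtain ⟨U, hU, hup, ha, hbU⟩ := exists_isClopen_upper_of_not_le hb
    exact ⟨Uᶜ, fun z hz hz' => hz (hup hz' ha), hU.compl.isOpen, hbU⟩
  refine zorn_le_nonempty₀ C ?_ x hx
  intro c hcC hc y hy
  have : Nonempty c := ⟨⟨y, hy⟩⟩
  obtain ⟨z, hz⟩ := IsCompact.nonempty_iInter_of_directed_nonempty_isCompact_isClosed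
    (fun a : c => C ∩ Set.Ici (a : X)) (by
      intro a b
      rcases hc.total a.2 b.2 with h | h
      · exact ⟨b, fun w hw => ⟨hw.1, h.trans hw.2⟩, fun w hw => hw⟩
      · exact ⟨a, fun w hw => hw, fun w hw => ⟨hw.1, h.trans hw.2⟩⟩)
    (fun a => ⟨a, hcC a.2, le_rfl⟩) (fun a => (hC.inter (hIci _)).isCompact)
    (fun a => hC.inter (hIci _))
  rw [Set.mem_iInter] at hz
  exact ⟨z, (hz ⟨y, hy⟩).1, fun a ha => (hz ⟨a, ha⟩).2⟩

theorem admissibleClopen_iff {X : Type u} [TopologicalSpace X] [PartialOrder X] [CompactSpace X]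
    [PriestleySpace X] (X₀ U : Set X) : AdmissibleClopen X₀ U ↔
      IsClopen U ∧ IsUpperSet U ∧ ∀ x ∉ U, ∃ y ∈ X₀, y ∉ U ∧ x ≤ y := by
  refine and_congr_right fun h1 => and_congr_right fun h2 => ?_
  constructor
  · intro h x hx
    obtain ⟨y, hxy, hy⟩ := exists_maximal (C := Uᶜ) h1.compl.isClosed hx
    exact ⟨y, h y hy, hy.1, hxy⟩
  · intro h x hx
    obtain ⟨y, hy, hyU, hxy⟩ := h x hx.1
    rwa [le_antisymm hxy (hx.2 hyU hxy)]

/-- A closed upset `C` is admissible if `X \ C = ↓(X₀ \ C)`. -/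
def PGPS.AdmClosed (X : PGPS.{u}) (C : Set X) : Prop :=
  IsClosed C ∧ IsUpperSet C ∧ Cᶜ = (lowerClosure (X.X₀ \ C) : Set X)

theorem PGPS.admClosed_iff (X : PGPS.{u}) (C : Set X) : X.AdmClosed C ↔
    IsClosed C ∧ IsUpperSet C ∧ ∀ x ∉ C, ∃ y ∈ X.X₀, y ∉ C ∧ x ≤ y := by
  refine and_congr_right fun h1 => and_congr_right fun h2 => ?_
  constructor
  · intro h x hx
    have hx' : x ∈ (lowerClosure (X.X₀ \ C) : Set X) := h ▸ hx
    obtain ⟨y, hy, hxy⟩ := hx'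
    exact ⟨y, hy.1, hy.2, hxy⟩
  · intro h
    ext x
    constructor
    · intro hx
      obtain ⟨y, hy, hyC, hxy⟩ := h x hx
      exact ⟨y, ⟨hy, hyC⟩, hxy⟩
    · rintro ⟨y, hy, hxy⟩ hx
      exact hy.2 (h2 hxy hx)

theorem PGPS.Adm.admClosed {X : PGPS.{u}} {U : Set X} (h : X.Adm U) : X.AdmClosed U := by
  rw [X.admClosed_iff]
  obtain ⟨h1, h2, h3⟩ := (admissibleClopen_iff _ _).1 h
  exact ⟨h1.isClosed, h2, h3⟩

/-- The set `𝒱ᵃ(X)` of admissible closed upsets of `X`. -/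
structure Va (X : PGPS.{u}) : Type u where
  val : Set X
  property : X.AdmClosed val

theorem Va.ext {X : PGPS.{u}} {C D : Va X} (h : C.val = D.val) : C = D := by
  cases C; cases D; cases h; rfl

/-- `𝒱ᵃ(X)` is ordered by reverse inclusion. -/
instance (X : PGPS.{u}) : PartialOrder (Va X) where
  le C D := D.val ⊆ C.val
  le_refl C := fun _ h => h
  le_trans C D E h1 h2 := fun _ h => h1 (h2 h)
  le_antisymm C D h1 h2 := Va.ext (Set.Subset.antisymm h2 h1)

theorem Va.le_def {X : PGPS.{u}} {C D : Va X} : C ≤ D ↔ D.val ⊆ C.val := Iff.rfl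

theorem admClosed_sInter {X : PGPS.{u}} (S : Set (Set X)) (h : ∀ C ∈ S, X.AdmClosed C) :
    X.AdmClosed (⋂₀ S) := by
  rw [X.admClosed_iff]
  refine ⟨isClosed_sInter fun C hC => (h C hC).1, isUpperSet_sInter fun C hC => (h C hC).2.1, ?_⟩
  intro x hx
  simp only [Set.mem_sInter, not_forall] at hx
  obtain ⟨C, hC, hxC⟩ := hx
  obtain ⟨y, hy, hyC, hxy⟩ := ((X.admClosed_iff C).1 (h C hC)).2.2 x hxC
  exact ⟨y, hy, fun h' => hyC (h' C hC), hxy⟩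

/-- Joins in `𝒱ᵃ(X)` are intersections. -/
instance (X : PGPS.{u}) : SupSet (Va X) where
  sSup S := ⟨⋂₀ (Va.val '' S), admClosed_sInter _ (by rintro _ ⟨C, _, rfl⟩; exact C.property)⟩

theorem Va.mem_sSup {X : PGPS.{u}} (S : Set (Va X)) (x : X) :
    x ∈ (sSup S).val ↔ ∀ C ∈ S, x ∈ C.val := by
  change x ∈ ⋂₀ (Va.val '' S) ↔ _
  simp

instance (X : PGPS.{u}) : CompleteLattice (Va X) :=
  completeLatticeOfSup (Va X) fun S => by
    constructor
    · intro C hC x hx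
      exact (Va.mem_sSup S x).1 hx C hC
    · intro D hD x hx
      exact (Va.mem_sSup S x).2 fun C hC => hD hC hx

theorem PGPS.separation {X : PGPS.{u}} {C : Set X} (hC : X.AdmClosed C) {y : X} (hy : y ∉ C) :
    ∃ U, X.Adm U ∧ C ⊆ U ∧ y ∉ U := by
  obtain ⟨z, hz, hzC, hyz⟩ := ((X.admClosed_iff C).1 hC).2.2 y hy
  obtain ⟨hne, hdir⟩ := (X.mem_X₀_iff z).1 hz
  have hU : ∀ x : C, ∃ U, U ∈ missing X.X₀ z ∧ x.1 ∈ U := by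
    intro x
    have hxz : ¬ x.1 ≤ z := fun h => hzC (hC.2.1 h x.2)
    rw [X.le_iff] at hxz
    push Not at hxz
    obtain ⟨U, hU, hx, hzU⟩ := hxz
    exact ⟨U, ⟨hU, hzU⟩, hx⟩
  choose U hU hxU using hU
  obtain ⟨t, ht⟩ := hC.1.isCompact.elim_finite_subcover U (fun x => (hU x).1.1.isOpen)
    (fun x hx => Set.mem_iUnion.2 ⟨⟨x, hx⟩, hxU ⟨x, hx⟩⟩)
  have key : ∃ V ∈ missing X.X₀ z, ∀ i ∈ t, U i ⊆ V := by
    clear ht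
    classical
    induction t using Finset.induction_on with
    | empty => exact ⟨hne.some, hne.some_mem, by simp⟩
    | insert a s _ ih =>
      obtain ⟨V, hV, hs⟩ := ih
      obtain ⟨W, hW, h1, h2⟩ := hdir V hV (U a) (hU a)
      refine ⟨W, hW, fun i hi => ?_⟩
      rcases Finset.mem_insert.1 hi with rfl | hi
      · exact h2
      · exact (hs i hi).trans h1
  obtain ⟨V, hV, hs⟩ := key
  refine ⟨V, hV.1, fun x hx => ?_, fun h => hV.2 (hV.1.2.1 hyz h)⟩
  obtain ⟨i, hi, hxi⟩ := Set.mem_iUnion₂.1 (ht hx)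
  exact hs i hi hxi

theorem Va.mem_inf {X : PGPS.{u}} {A B : Va X} {x : X} (hx : x ∈ X.X₀)
    (h : x ∈ (A ⊓ B).val) : x ∈ A.val ∨ x ∈ B.val := by
  by_contra hn
  push Not at hn
  obtain ⟨U, hU, hAU, hxU⟩ := X.separation A.property hn.1
  obtain ⟨V, hV, hBV, hxV⟩ := X.separation B.property hn.2
  obtain ⟨W, hW, h1, h2⟩ := ((X.mem_X₀_iff x).1 hx).2 U ⟨hU, hxU⟩ V ⟨hV, hxV⟩
  have hle : (⟨W, PGPS.Adm.admClosed hW.1⟩ : Va X) ≤ A ⊓ B :=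
    le_inf (hAU.trans h1) (hBV.trans h2)
  exact hW.2 (hle h)

instance (X : PGPS.{u}) : Order.Frame (Va X) :=
  Order.Frame.ofMinimalAxioms ⟨fun A S => by
    intro x hx
    by_contra hn
    obtain ⟨y, hy, hyn, hxy⟩ := ((X.admClosed_iff _).1 (A ⊓ sSup S).property).2.2 x hn
    have hyA : y ∉ A.val := fun h => hyn ((inf_le_left : A ⊓ sSup S ≤ A) h)
    have hyS : y ∉ (sSup S).val := fun h => hyn ((inf_le_right : A ⊓ sSup S ≤ sSup S) h)
    rw [Va.mem_sSup] at hyS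
    push Not at hyS
    obtain ⟨B, hB, hyB⟩ := hyS
    have h1 : y ∈ (⨆ b ∈ S, A ⊓ b).val := (⨆ b ∈ S, A ⊓ b).property.2.1 hxy hx
    have h2 : y ∈ (A ⊓ B).val := (le_iSup₂_of_le B hB le_rfl : A ⊓ B ≤ ⨆ b ∈ S, A ⊓ b) h1
    rcases Va.mem_inf hy h2 with h | h
    · exact hyA h
    · exact hyB h⟩

theorem Va.eq_sSup {X : PGPS.{u}} (C : Va X) : sSup {D : Va X | X.Adm D.val ∧ D ≤ C} = C := by
  apply le_antisymm
  · exact sSup_le fun D hD => hD.2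
  · intro x hx
    by_contra hn
    obtain ⟨U, hU, hCU, hxU⟩ := X.separation C.property hn
    exact hxU ((Va.mem_sSup _ x).1 hx ⟨U, hU.admClosed⟩ ⟨hU, hCU⟩)

/-- The compact elements of `𝒱ᵃ(X)` are the admissible clopen upsets. -/
theorem Va.compact_iff {X : PGPS.{u}} (C : Va X) : IsCompactElement C ↔ X.Adm C.val := by
  rw [GenPriestley.compact_iff]
  constructor
  · intro h
    obtain ⟨T, hT, hf, hC⟩ := h _ C.eq_sSup.ge
    have hCT : C = sSup T :=
      le_antisymm hC (sSup_le fun D hD => (hT hD).2)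
    refine (admissibleClopen_iff _ _).2 ⟨?_, C.property.2.1, ((X.admClosed_iff _).1 C.property).2.2⟩
    have : C.val = ⋂ D ∈ T, D.val := by
      ext x
      conv_lhs => rw [hCT]
      rw [Va.mem_sSup]
      simp
    rw [this]
    exact hf.isClopen_biInter fun D hD => (hT hD).1.1
  · intro h S hS
    obtain ⟨t, ht⟩ := h.1.compl.isClosed.isCompact.elim_finite_subcover
      (fun D : S => (D.1.val)ᶜ) (fun D => D.1.property.1.isOpen_compl) (by
        intro x hx
        by_contra hn
        refine hx (hS ((Va.mem_sSup S x).2 fun D hD => ?_))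
        by_contra hxD
        exact hn (Set.mem_iUnion.2 ⟨⟨D, hD⟩, hxD⟩))
    refine ⟨Subtype.val '' (t : Set S), ?_, t.finite_toSet.image _, ?_⟩
    · rintro _ ⟨D, _, rfl⟩
      exact D.2
    · intro x hx
      by_contra hn
      obtain ⟨D, hD, hxD⟩ := Set.mem_iUnion₂.1 (ht hn)
      exact hxD ((Va.mem_sSup _ x).1 hx D ⟨D, hD, rfl⟩)

instance (X : PGPS.{u}) : IsCompactlyGenerated (Va X) where
  exists_sSup_eq C := ⟨_, fun D hD => (Va.compact_iff D).2 hD.1, C.eq_sSup⟩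

theorem box_admClosed {X Y : PGPS.{u}} (R : GPMor X Y) {C : Set Y} (hC : Y.AdmClosed C) :
    X.AdmClosed (box R.rel C) := by
  have : box R.rel C = ⋂₀ {V | ∃ U, Y.Adm U ∧ C ⊆ U ∧ V = box R.rel U} := by
    ext x
    constructor
    · rintro hx _ ⟨U, hU, hCU, rfl⟩ y hy
      exact hCU (hx y hy)
    · intro hx y hy
      by_contra hn
      obtain ⟨U, hU, hCU, hyU⟩ := Y.separation hC hn
      exact hyU (hx _ ⟨U, hU, hCU, rfl⟩ y hy)
  rw [this]
  apply admClosed_sInter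
  rintro _ ⟨U, hU, _, rfl⟩
  exact PGPS.Adm.admClosed (R.box_adm U hU)

/-- `□_R` as a map `𝒱ᵃ(Y) → 𝒱ᵃ(X)`. -/
def Va.box {X Y : PGPS.{u}} (R : GPMor X Y) (C : Va Y) : Va X :=
  ⟨GenPriestley.box R.rel C.val, box_admClosed R C.property⟩

theorem box_star_admClosed {X Y Z : PGPS.{u}} (R : GPMor X Y) (S : GPMor Y Z) {C : Set Z}
    (hC : Z.AdmClosed C) : box (R.comp S).rel C = box R.rel (box S.rel C) := by
  ext x
  constructor
  · intro h y hxy t hyt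
    exact h t fun W _ hx => hx y hxy t hyt
  · intro h z hz
    by_contra hn
    obtain ⟨U, hU, hCU, hzU⟩ := Z.separation hC hn
    exact hzU (hz U hU fun y hy t ht => hCU (h y hy t ht))

/-- The contravariant functor `𝒱ᵃ`, `X ↦ 𝒱ᵃ(X)`, `R ↦ □_R`. -/
abbrev functorV : PGPS.{u}ᵒᵖ ⥤ AlgFrmJ.{u} where
  obj X := ⟨Va X.unop⟩
  map {Y X} R :=
    { toFun := Va.box R.unop
      map_sSup := by
        intro S
        apply Va.ext
        ext x
        rw [Va.mem_sSup]
        constructor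
        · rintro hx _ ⟨C, hC, rfl⟩ y hy
          exact (Va.mem_sSup S y).1 (hx y hy) C hC
        · intro hx y hy
          exact (Va.mem_sSup S y).2 fun C hC => hx _ ⟨C, hC, rfl⟩ y hy
      map_compact := by
        intro C hC
        rw [Va.compact_iff] at hC ⊢
        exact GPMor.box_adm R.unop _ hC }
  map_id X := JMor.ext (funext fun C => Va.ext (X.unop.box_le C.property.2.1))
  map_comp {X Y Z} R S := JMor.ext (funext fun C => Va.ext
    (box_star_admClosed S.unop R.unop C.property))

/-! ### MeetPrime and pseudoprime elements -/

/-- The way below relation. -/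
def WayBelow {L : Type u} [CompleteLattice L] (a b : L) : Prop :=
  ∀ S : Set L, b ≤ sSup S → ∃ T ⊆ S, T.Finite ∧ a ≤ sSup T

/-- An element `p ≠ 1` is pseudoprime if `a₁ ∧ ⋯ ∧ aₙ ≪ p` implies `aᵢ ≤ p` for some `i`. -/
def Pseudoprime {L : Type u} [CompleteLattice L] (p : L) : Prop :=
  p ≠ ⊤ ∧ ∀ S : Set L, S.Finite → WayBelow (sInf S) p → ∃ a ∈ S, a ≤ p

/-- MeetPrime elements. -/
def MeetPrime {L : Type u} [CompleteLattice L] (p : L) : Prop :=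
  p ≠ ⊤ ∧ ∀ a b : L, a ⊓ b ≤ p → a ≤ p ∨ b ≤ p

theorem wayBelow_iff {L : Type u} [CompleteLattice L] [IsCompactlyGenerated L] {a b : L} :
    WayBelow a b ↔ ∃ t, IsCompactElement t ∧ a ≤ t ∧ t ≤ b := by
  constructor
  · intro h
    obtain ⟨T, hT, hf, ha⟩ := h {c | IsCompactElement c ∧ c ≤ b} (sSup_compact_le_eq b).ge
    exact ⟨sSup T, compact_sSup hf fun k hk => (hT hk).1, ha, sSup_le fun k hk => (hT hk).2⟩
  · rintro ⟨t, ht, hat, htb⟩ S hS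
    obtain ⟨T, hT, hf, h⟩ := (compact_iff t).1 ht S (htb.trans hS)
    exact ⟨T, hT, hf, hat.trans h⟩

/-- The set `Y_L` of pseudoprime elements together with the top element. -/
def pseudoprimesTop (L : Type u) [CompleteLattice L] : Set L := {p | Pseudoprime p} ∪ {⊤}

/-- The topology on an algebraic lattice generated by the sets `↑k` and `(↑l)ᶜ` for compact
`k`, `l`. -/
abbrev latticeTopology (L : Type u) [CompleteLattice L] : TopologicalSpace L :=
  TopologicalSpace.generateFrom
    ({U | ∃ k, IsCompactElement k ∧ U = Set.Ici k} ∪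
      {U | ∃ l, IsCompactElement l ∧ U = (Set.Ici l)ᶜ})

/-- `Y_L` with the restrictions of the order and of the topology of `L`. -/
def YSp (L : AlgFrmJ.{u}) : Type u := {p : L // p ∈ pseudoprimesTop L}

instance (L : AlgFrmJ.{u}) : PartialOrder (YSp L) := inferInstanceAs (PartialOrder {p // p ∈ pseudoprimesTop L})

instance (L : AlgFrmJ.{u}) : TopologicalSpace (YSp L) :=
  (latticeTopology L).induced Subtype.val

/-- The prime elements of `L`, as a subset of `Y_L`. -/
def YSp.primes (L : AlgFrmJ.{u}) : Set (YSp L) := {p | MeetPrime p.val}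

/-- The trace of `↑a` on `Y_L`. -/
def up {L : AlgFrmJ.{u}} (a : L) : Set (YSp L) := {p | a ≤ p.val}

theorem MeetPrime.sInf_le {L : Type u} [CompleteLattice L] {p : L} (hp : MeetPrime p) {S : Set L}
    (hS : S.Finite) (h : sInf S ≤ p) : ∃ a ∈ S, a ≤ p := by
  induction S, hS using Set.Finite.induction_on with
  | empty => exact absurd (top_le_iff.1 (by simpa using h)) hp.1
  | insert _ _ ih =>
    rw [sInf_insert] at h
    rcases hp.2 _ _ h with h | h
    · exact ⟨_, Set.mem_insert _ _, h⟩
    · obtain ⟨a, ha, h⟩ := ih h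
      exact ⟨a, Set.mem_insert_of_mem _ ha, h⟩

theorem MeetPrime.pseudoprime {L : Type u} [CompleteLattice L] [IsCompactlyGenerated L] {p : L}
    (hp : MeetPrime p) : Pseudoprime p := by
  refine ⟨hp.1, fun S hS h => ?_⟩
  obtain ⟨t, _, h1, h2⟩ := wayBelow_iff.1 h
  exact hp.sInf_le hS (h1.trans h2)

theorem exists_prime {L : AlgFrmJ.{u}} {a b : L} (h : ¬ a ≤ b) :
    ∃ p, MeetPrime p ∧ b ≤ p ∧ ¬ a ≤ p := by
  obtain ⟨k, hk, hka, hkb⟩ := exists_compact h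
  obtain ⟨p, hbp, hp⟩ := zorn_le_nonempty₀ {x : L | ¬ k ≤ x} (by
    intro c hc hchain y hy
    refine ⟨sSup c, fun hle => ?_, fun z hz => le_sSup hz⟩
    obtain ⟨x, hx, hkx⟩ := (CompleteLattice.isCompactElement_iff_le_of_directed_sSup_le _ k).1 hk c
      ⟨y, hy⟩ hchain.directedOn hle
    exact hc hx hkx) b hkb
  have hmax : ∀ x : L, ¬ x ≤ p → k ≤ p ⊔ x := by
    intro x hx
    by_contra hn
    exact hx (le_sup_right.trans (hp.2 hn le_sup_left))
  refine ⟨p, ⟨fun hT => hp.1 (hT ▸ le_top), fun x y hxy => ?_⟩, hbp, fun h' => hp.1 (hka.trans h')⟩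
  by_contra hn
  push Not at hn
  have h1 : k ≤ (p ⊔ x) ⊓ (p ⊔ y) := le_inf (hmax x hn.1) (hmax y hn.2)
  rw [← sup_inf_left, sup_eq_left.2 hxy] at h1
  exact hp.1 h1

theorem exists_prime' {L : AlgFrmJ.{u}} {a b : L} (h : ¬ a ≤ b) :
    ∃ p : YSp L, p ∈ YSp.primes L ∧ b ≤ p.val ∧ ¬ a ≤ p.val := by
  obtain ⟨p, hp, h1, h2⟩ := exists_prime h
  exact ⟨⟨p, Or.inl hp.pseudoprime⟩, hp, h1, h2⟩

theorem isClopen_up {L : AlgFrmJ.{u}} {k : L} (hk : IsCompactElement k) : IsClopen (up k) := by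
  constructor
  · rw [← isOpen_compl_iff]
    exact ⟨(Set.Ici k)ᶜ, TopologicalSpace.isOpen_generateFrom_of_mem (Or.inr ⟨k, hk, rfl⟩), rfl⟩
  · exact ⟨Set.Ici k, TopologicalSpace.isOpen_generateFrom_of_mem (Or.inl ⟨k, hk, rfl⟩), rfl⟩

theorem isUpperSet_up {L : AlgFrmJ.{u}} (a : L) : IsUpperSet (up a) :=
  fun _ _ hpq hp => le_trans (b := _) hp hpq

instance (L : AlgFrmJ.{u}) : PriestleySpace (YSp L) where
  priestley {p q} h := by
    obtain ⟨k, hk, hkp, hkq⟩ := exists_compact (a := p.val) (b := q.val) h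
    exact ⟨up k, isClopen_up hk, isUpperSet_up k, hkp, hkq⟩

theorem YSp.topology_eq (L : AlgFrmJ.{u}) :
    (inferInstance : TopologicalSpace (YSp L)) = TopologicalSpace.generateFrom
      ({U | ∃ k : L, IsCompactElement k ∧ U = up k} ∪
        {U | ∃ k : L, IsCompactElement k ∧ U = (up k)ᶜ}) := by
  change (latticeTopology L).induced Subtype.val = _
  unfold latticeTopology
  rw [induced_generateFrom_eq]
  congr 1
  ext U
  constructor
  · rintro ⟨_, ⟨k, hk, rfl⟩ | ⟨k, hk, rfl⟩, rfl⟩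
    · exact Or.inl ⟨k, hk, rfl⟩
    · exact Or.inr ⟨k, hk, rfl⟩
  · rintro (⟨k, hk, rfl⟩ | ⟨k, hk, rfl⟩)
    · exact ⟨_, Or.inl ⟨k, hk, rfl⟩, rfl⟩
    · exact ⟨_, Or.inr ⟨k, hk, rfl⟩, rfl⟩

instance (L : AlgFrmJ.{u}) : CompactSpace (YSp L) where
  isCompact_univ := by
    rw [isCompact_iff_ultrafilter_le_nhds]
    intro F _
    set K : Set L := {k | IsCompactElement k ∧ up k ∈ F} with hK
    set a : L := sSup K with ha
    have hka : ∀ k : L, IsCompactElement k → (k ≤ a ↔ up k ∈ F) := by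
      intro k hk
      constructor
      · intro h
        obtain ⟨T, hT, hf, hkT⟩ := (compact_iff k).1 hk K h
        have h1 : ⋂ t ∈ T, up t ∈ F := by
          rw [← Ultrafilter.mem_coe, Filter.biInter_mem hf]
          exact fun t ht => (hT ht).2
        refine Filter.mem_of_superset h1 fun p hp => hkT.trans (sSup_le fun t ht => ?_)
        exact Set.mem_iInter₂.1 hp t ht
      · intro h
        exact le_sSup ⟨hk, h⟩
    have haY : a ∈ pseudoprimesTop L := by
      by_contra hn
      have hn' : a ≠ ⊤ ∧ ¬ Pseudoprime a := ⟨fun h => hn (Or.inr h), fun h => hn (Or.inl h)⟩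
      have hn2 : ∃ S : Set L, S.Finite ∧ WayBelow (sInf S) a ∧ ∀ s ∈ S, ¬ s ≤ a := by
        by_contra hc
        push Not at hc
        exact hn'.2 ⟨hn'.1, hc⟩
      obtain ⟨S, hS, hw, hs⟩ := hn2
      obtain ⟨t, ht, hSt, hta⟩ := wayBelow_iff.1 hw
      have hc : ∀ s : S, ∃ k, IsCompactElement k ∧ k ≤ s.1 ∧ ¬ k ≤ a :=
        fun s => exists_compact (hs s.1 s.2)
      choose k hk hks hka' using hc
      have := hS.to_subtype
      have h1 : up t ∩ ⋂ s : S, (up (k s))ᶜ ∈ F := by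
        refine Filter.inter_mem ((hka t ht).1 hta) ?_
        rw [Filter.iInter_mem]
        intro s
        refine Ultrafilter.compl_mem_iff_notMem.2 fun h => hka' s ((hka _ (hk s)).2 h)
      obtain ⟨q, hq1, hq2⟩ := F.neBot.nonempty_of_mem h1
      rw [Set.mem_iInter] at hq2
      have hSne : S.Nonempty := by
        rw [Set.nonempty_iff_ne_empty]
        rintro rfl
        rw [sInf_empty] at hSt
        exact hn'.1 (top_le_iff.1 (hSt.trans hta))
      rcases q.2 with hq | hq
      · obtain ⟨s, hsS, hsq⟩ := hq.2 S hS (wayBelow_iff.2 ⟨t, ht, hSt, hq1⟩)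
        exact hq2 ⟨s, hsS⟩ ((hks ⟨s, hsS⟩).trans hsq)
      · obtain ⟨s, hsS⟩ := hSne
        refine hq2 ⟨s, hsS⟩ ?_
        have : q.val = ⊤ := hq
        change _ ≤ q.val
        rw [this]
        exact le_top
    refine ⟨⟨a, haY⟩, trivial, ?_⟩
    have htop := YSp.topology_eq L
    have hn := @TopologicalSpace.nhds_generateFrom (YSp L)
      ({U | ∃ k : L, IsCompactElement k ∧ U = up k} ∪
        {U | ∃ k : L, IsCompactElement k ∧ U = (up k)ᶜ}) ⟨a, haY⟩
    rw [← htop] at hn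
    refine le_trans ?_ hn.ge
    refine le_iInf₂ fun U hU => Filter.le_principal_iff.2 ?_
    obtain ⟨haU, ⟨k, hk, rfl⟩ | ⟨k, hk, rfl⟩⟩ := hU
    · exact (hka k hk).1 haU
    · exact Ultrafilter.compl_mem_iff_notMem.2 fun h => haU ((hka _ hk).2 h)

/-- The admissible clopen upsets of `Y_L` are the sets `↑k ∩ Y_L` for compact `k`. -/
theorem admissible_Y_iff {L : AlgFrmJ.{u}} (U : Set (YSp L)) :
    AdmissibleClopen (YSp.primes L) U ↔ ∃ k : L, IsCompactElement k ∧ U = up k := by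
  rw [admissibleClopen_iff]
  constructor
  · rintro ⟨hcl, hup, hmax⟩
    have h1 : ∀ p ∈ YSp.primes L, p ∉ U → ∃ k : L, IsCompactElement k ∧ U ⊆ up k ∧ p ∉ up k := by
      intro p hp hpU
      have h2 : ∀ u : U, ∃ k, IsCompactElement k ∧ k ≤ u.1.val ∧ ¬ k ≤ p.val :=
        fun u => exists_compact fun h => hpU (hup (a := u.1) h u.2)
      choose k hk hku hkp using h2
      obtain ⟨t, ht⟩ := hcl.isClosed.isCompact.elim_finite_subcover (fun u : U => up (k u))
        (fun u => (isClopen_up (hk u)).isOpen) (fun u hu => Set.mem_iUnion.2 ⟨⟨u, hu⟩, hku ⟨u, hu⟩⟩)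
      have h3 : ¬ sInf (k '' (t : Set U)) ≤ p.val := by
        intro h
        obtain ⟨_, ⟨u, _, rfl⟩, h⟩ := hp.sInf_le (t.finite_toSet.image k) h
        exact hkp u h
      obtain ⟨l, hl, hlk, hlp⟩ := exists_compact h3
      refine ⟨l, hl, fun u hu => ?_, hlp⟩
      obtain ⟨v, hv, huv⟩ := Set.mem_iUnion₂.1 (ht hu)
      have h4 : sInf (k '' (t : Set U)) ≤ k v := sInf_le (Set.mem_image_of_mem k hv)
      exact hlk.trans (h4.trans huv)
    have h2 : ∀ q : (Uᶜ : Set (YSp L)), ∃ k : L, IsCompactElement k ∧ U ⊆ up k ∧ q.1 ∉ up k := by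
      rintro ⟨q, hq⟩
      obtain ⟨p, hp, hpU, hqp⟩ := hmax q hq
      obtain ⟨k, hk, hUk, hpk⟩ := h1 p hp hpU
      exact ⟨k, hk, hUk, fun h => hpk (isUpperSet_up k hqp h)⟩
    choose k hk hUk hqk using h2
    obtain ⟨t, ht⟩ := hcl.compl.isClosed.isCompact.elim_finite_subcover
      (fun q : (Uᶜ : Set (YSp L)) => (up (k q))ᶜ)
      (fun q => (isClopen_up (hk q)).compl.isOpen)
      (fun q hq => Set.mem_iUnion.2 ⟨⟨q, hq⟩, hqk ⟨q, hq⟩⟩)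
    refine ⟨sSup (k '' (t : Set _)), compact_sSup (t.finite_toSet.image k) ?_, ?_⟩
    · rintro _ ⟨q, _, rfl⟩
      exact hk q
    · ext q
      constructor
      · intro hq
        apply sSup_le
        rintro _ ⟨r, _, rfl⟩
        exact hUk r hq
      · intro hq
        by_contra hn
        obtain ⟨r, hr, hqr⟩ := Set.mem_iUnion₂.1 (ht hn)
        have h3 : k r ≤ sSup (k '' (t : Set _)) := le_sSup (Set.mem_image_of_mem k hr)
        exact hqr (h3.trans hq)
  · rintro ⟨k, hk, rfl⟩
    refine ⟨isClopen_up hk, isUpperSet_up k, fun q hq => ?_⟩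
    obtain ⟨p, hp, h1, h2⟩ := exists_prime' (a := k) (b := q.val) hq
    exact ⟨p, hp, h2, h1⟩

theorem nhds_basis {L : AlgFrmJ.{u}} {q : YSp L} {W : Set (YSp L)} (hW : IsOpen W) (hq : q ∈ W) :
    ∃ k : L, IsCompactElement k ∧ k ≤ q.val ∧ ∃ T : Set L, T.Finite ∧
      (∀ l ∈ T, ¬ l ≤ q.val) ∧ ∀ x : YSp L, k ≤ x.val → (∀ l ∈ T, ¬ l ≤ x.val) → x ∈ W := by
  have hb := TopologicalSpace.isTopologicalBasis_of_subbasis (YSp.topology_eq L)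
  obtain ⟨_, ⟨f, ⟨hf, hfs⟩, rfl⟩, hqf, hfW⟩ := hb.exists_subset_of_mem_open hq hW
  have key : ∃ k : L, IsCompactElement k ∧ k ≤ q.val ∧ ∃ T : Set L, T.Finite ∧
      (∀ l ∈ T, ¬ l ≤ q.val) ∧ ∀ x : YSp L, k ≤ x.val → (∀ l ∈ T, ¬ l ≤ x.val) → x ∈ ⋂₀ f := by
    clear hfW
    induction f, hf using Set.Finite.induction_on with
    | empty => exact ⟨sSup ∅, compact_sSup Set.finite_empty (by simp), by simp, ∅,
        Set.finite_empty, by simp, by simp⟩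
    | @insert U f _ _ ih =>
      have hqf : q ∈ ⋂₀ insert U f := hqf
      rw [Set.sInter_insert] at hqf
      obtain ⟨k, hk, hkq, T, hT, hTq, h⟩ := ih ((Set.subset_insert U f).trans hfs) hqf.2
      rcases hfs (Set.mem_insert U f) with ⟨l, hl, rfl⟩ | ⟨l, hl, rfl⟩
      · refine ⟨sSup {k, l}, compact_sSup (by simp) (by simp [hk, hl]), ?_, T, hT, hTq, ?_⟩
        · rw [sSup_pair]
          exact sup_le hkq hqf.1
        · intro x hx hxT
          rw [sSup_pair] at hx
          rw [Set.sInter_insert]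
          exact ⟨le_sup_right.trans hx, h x (le_sup_left.trans hx) hxT⟩
      · refine ⟨k, hk, hkq, insert l T, hT.insert l, ?_, ?_⟩
        · intro t ht
          rcases Set.mem_insert_iff.1 ht with rfl | ht
          · exact hqf.1
          · exact hTq t ht
        · intro x hx hxT
          rw [Set.sInter_insert]
          exact ⟨hxT l (Set.mem_insert _ _), h x hx fun t ht => hxT t (Set.mem_insert_of_mem _ ht)⟩
  obtain ⟨k, hk, hkq, T, hT, hTq, h⟩ := key
  exact ⟨k, hk, hkq, T, hT, hTq, fun x h1 h2 => hfW (h x h1 h2)⟩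

/-- The pointed generalized Priestley space `⟨Y_L, τ, ≤, P(L), 1⟩`. -/
abbrev YObj (L : AlgFrmJ.{u}) : PGPS.{u} where
  carrier := YSp L
  X₀ := YSp.primes L
  m := ⟨⊤, Or.inr rfl⟩
  le_m p := le_top (a := p.val)
  X₀_subset p hp h := hp.1 (congrArg Subtype.val h)
  dense := by
    intro q hq
    have hqp : Pseudoprime q.val := q.2.resolve_right fun h => hq (Subtype.ext h)
    rw [mem_closure_iff]
    intro W hW hqW
    obtain ⟨k, hk, hkq, T, hT, hTq, h⟩ := nhds_basis hW hqW
    have h1 : ¬ sInf T ≤ k := fun hle => by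
      obtain ⟨l, hl, hlq⟩ := hqp.2 T hT (wayBelow_iff.2 ⟨k, hk, hle, hkq⟩)
      exact hTq l hl hlq
    obtain ⟨p, hp, hkp, hTp⟩ := exists_prime' h1
    exact ⟨p, h p hkp fun l hl hlp => hTp ((sInf_le hl).trans hlp), hp⟩
  order_dense q hq := by
    have h1 : ¬ (⊤ : L) ≤ q.val := fun h => hq (Subtype.ext (top_le_iff.1 h))
    obtain ⟨p, hp, hqp, _⟩ := exists_prime' h1
    exact ⟨p, hp, hqp⟩
  mem_X₀_iff a := by
    constructor
    · intro ha
      constructor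
      · have h1 : ¬ (⊤ : L) ≤ a.val := fun h => ha.1 (top_le_iff.1 h)
        obtain ⟨k, hk, _, hka⟩ := exists_compact h1
        exact ⟨up k, (admissible_Y_iff _).2 ⟨k, hk, rfl⟩, hka⟩
      · rintro U ⟨hU, haU⟩ W ⟨hW, haW⟩
        obtain ⟨k, hk, rfl⟩ := (admissible_Y_iff _).1 hU
        obtain ⟨l, hl, rfl⟩ := (admissible_Y_iff _).1 hW
        have h1 : ¬ k ⊓ l ≤ a.val := fun h => (ha.2 k l h).elim haU haW
        obtain ⟨t, ht, htkl, hta⟩ := exists_compact h1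
        refine ⟨up t, ⟨(admissible_Y_iff _).2 ⟨t, ht, rfl⟩, hta⟩, ?_, ?_⟩
        · exact fun p hp => (htkl.trans inf_le_left).trans hp
        · exact fun p hp => (htkl.trans inf_le_right).trans hp
    · rintro ⟨⟨U, hU, haU⟩, hdir⟩
      refine ⟨fun h => ?_, fun x y hxy => ?_⟩
      · obtain ⟨k, hk, rfl⟩ := (admissible_Y_iff _).1 hU
        exact haU (le_top.trans h.ge)
      · by_contra hn
        push Not at hn
        obtain ⟨k, hk, hkx, hka⟩ := exists_compact hn.1
        obtain ⟨l, hl, hly, hla⟩ := exists_compact hn.2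
        obtain ⟨W, ⟨hW, haW⟩, h1, h2⟩ := hdir (up k) ⟨(admissible_Y_iff _).2 ⟨k, hk, rfl⟩, hka⟩
          (up l) ⟨(admissible_Y_iff _).2 ⟨l, hl, rfl⟩, hla⟩
        obtain ⟨t, ht, rfl⟩ := (admissible_Y_iff _).1 hW
        have h3 : ∀ s : L, up s ⊆ up t → t ≤ s := by
          intro s hs
          by_contra hts
          obtain ⟨p, _, hsp, htp⟩ := exists_prime' hts
          exact htp (hs hsp)
        exact haW (((le_inf (h3 k h1) (h3 l h2)).trans (inf_le_inf hkx hly)).trans hxy)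
  le_iff a b := by
    constructor
    · intro h U hU ha
      exact hU.2.1 h ha
    · intro h
      by_contra hn
      obtain ⟨k, hk, hka, hkb⟩ := exists_compact (a := a.val) (b := b.val) hn
      exact hkb (h (up k) ((admissible_Y_iff _).2 ⟨k, hk, rfl⟩) hka)

/-- The relation `R_α ⊆ Y_M × Y_L`: `p R_α q` iff `r(p) ≤ q`, where `r` is the right adjoint
of `α`. -/
def YRel {L M : AlgFrmJ.{u}} (α : JMor L M) (p : YObj M) (q : YObj L) : Prop :=
  α.rightAdjoint p.val ≤ q.val

theorem box_YRel {L M : AlgFrmJ.{u}} (α : JMor L M) (a : L) :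
    box (YRel α) (up a) = up (α.toFun a) := by
  ext p
  constructor
  · intro h
    by_contra hn
    have h1 : ¬ a ≤ α.rightAdjoint p.val := fun h' => hn ((α.gc a p.val).2 h')
    obtain ⟨q, _, hq1, hq2⟩ := exists_prime' h1
    exact hq2 (h q hq1)
  · intro h q hq
    exact ((α.gc a p.val).1 h).trans hq

/-- `R_α` as a generalized Priestley morphism. -/
def YMap {L M : AlgFrmJ.{u}} (α : JMor L M) : GPMor (YObj M) (YObj L) where
  rel := YRel α
  separates p q h := by
    obtain ⟨k, hk, hkp, hkq⟩ := exists_compact (a := α.rightAdjoint p.val) (b := q.val) h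
    exact ⟨up k, (admissible_Y_iff _).2 ⟨k, hk, rfl⟩, fun z hz => hkp.trans hz, hkq⟩
  box_adm U hU := by
    obtain ⟨k, hk, rfl⟩ := (admissible_Y_iff _).1 hU
    rw [box_YRel]
    exact (admissible_Y_iff _).2 ⟨_, α.map_compact k hk, rfl⟩

/-- The contravariant functor `𝒴`, `L ↦ Y_L`, `α ↦ R_α`. -/
abbrev functorY : AlgFrmJ.{u} ⥤ PGPS.{u}ᵒᵖ where
  obj L := op (YObj L)
  map α := Quiver.Hom.op (V := PGPS.{u}) (YMap α)
  map_id L := by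
    apply Quiver.Hom.unop_inj
    refine GPMor.ext_box fun U hU => ?_
    obtain ⟨k, hk, rfl⟩ := (admissible_Y_iff _).1 hU
    exact (box_YRel _ k).trans ((YObj L).box_le hU.2.1).symm
  map_comp {L M N} α β := by
    apply Quiver.Hom.unop_inj
    refine GPMor.ext_box fun U hU => ?_
    refine Eq.trans ?_ (GPMor.box_comp (YMap β) (YMap α) hU).symm
    obtain ⟨k, hk, rfl⟩ := (admissible_Y_iff _).1 hU
    change box (YRel (α ≫ β)) (up k) = box (YRel β) (box (YRel α) (up k))
    rw [box_YRel, box_YRel, box_YRel]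
    rfl

/-! ### Restrictions of the two functors -/

/-- The restriction `AlgFrm_S ⥤ PGPS_Fᵒᵖ` of `𝒴`, provided that `𝒴` sends morphisms of `AlgFrm_S`
to functional morphisms. -/
def restrictY (h : ∀ (L M : AlgFrmJ.{u}) (α : L ⟶ M), preservesCompactMeets α →
    functional (functorY.map α).unop) : AlgFrmS.{u} ⥤ PGPSF.{u}ᵒᵖ where
  obj L := op ⟨(functorY.obj L.obj).unop⟩
  map {L M} α := Quiver.Hom.op
    (X := (⟨(functorY.obj M.obj).unop⟩ : PGPSF.{u})) (Y := ⟨(functorY.obj L.obj).unop⟩)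
    ⟨(functorY.map α.hom).unop, h L.obj M.obj α.hom α.property⟩
  map_id L := by
    apply Quiver.Hom.unop_inj
    apply WideSubcategory.hom_ext
    exact congrArg Quiver.Hom.unop (functorY.map_id L.obj)
  map_comp α β := by
    apply Quiver.Hom.unop_inj
    apply WideSubcategory.hom_ext
    exact congrArg Quiver.Hom.unop (functorY.map_comp α.hom β.hom)

/-- The restriction `PGPS_Fᵒᵖ ⥤ AlgFrm_S` of `𝒱ᵃ`, provided that `𝒱ᵃ` sends functional morphisms
to morphisms of `AlgFrm_S`. -/
def restrictV (h : ∀ (X Y : PGPS.{u}) (R : X ⟶ Y), functional R →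
    preservesCompactMeets (functorV.map R.op)) : PGPSF.{u}ᵒᵖ ⥤ AlgFrmS.{u} where
  obj X := ⟨functorV.obj (op X.unop.obj)⟩
  map {Y X} R := ⟨functorV.map R.unop.hom.op, h X.unop.obj Y.unop.obj R.unop.hom R.unop.property⟩
  map_id X := WideSubcategory.hom_ext _ (functorV.map_id (op X.unop.obj))
  map_comp R S := WideSubcategory.hom_ext _
    (functorV.map_comp R.unop.hom.op S.unop.hom.op)

/-- The functor `AlgFrm_S ⥤ PGPS_Sᵒᵖ` obtained from the restriction of `𝒴` by replacing a functional
morphism `R` by the map `x ↦ min R[x]`. -/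
noncomputable def strongY (h : ∀ (L M : AlgFrmJ.{u}) (α : L ⟶ M), preservesCompactMeets α →
    functional (functorY.map α).unop) : AlgFrmS.{u} ⥤ PGPSS.{u}ᵒᵖ :=
  restrictY h ⋙ toStrong.op

/-- The functor `PGPS_Sᵒᵖ ⥤ AlgFrm_S` obtained by applying the restriction of `𝒱ᵃ` to the functional
morphisms `R_f`. -/
def strongV (h : ∀ (X Y : PGPS.{u}) (R : X ⟶ Y), functional R →
    preservesCompactMeets (functorV.map R.op)) : PGPSS.{u}ᵒᵖ ⥤ AlgFrmS.{u} :=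
  ofStrong.op ⋙ restrictV h

end GenPriestley

open GenPriestley

/-!
Compact elements are what both sides share: the admissible clopen upsets of `Y_L` are the sets
`↑k ∩ Y_L` with `k` compact, and the compact elements of `𝒱ᵃ(X)` are the admissible clopen upsets
of `X`. Since primes separate the elements of `L`, the map `a ↦ ↑a ∩ Y_L` is an order isomorphism
onto `𝒱ᵃ(Y_L)`. The map `x ↦ ↑x` from `X` to `Y_{𝒱ᵃ(X)}` is a continuous order embedding, so its
image is closed. The image is also dense: if `q` lies in `↑K` with `K` compact and in no `↑D` with
`D` in a finite set `T`, and every point of `K` belonged to some `D ∈ T`, then `⋀ T ≤ K ≪ q`,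
although `q` is pseudoprime.

The restriction to `AlgFrm_S` rests on a description of `Y_L`: an element `p` belongs to `Y_L` iff
`⋀ S ≤ p` implies `s ≤ p` for some `s ∈ S`, for all finite nonempty sets `S` of compact elements
whose meet is compact. These are exactly the meets that `AlgFrm_S`-morphisms preserve, so the right
adjoint `r` of such a morphism maps `Y_M` to `Y_L`, and `r(p)` is then the least element of
`R_α[p]`. In `𝒱ᵃ(X)` these meets are unions, because `X₀` is dense off `m`, and unions are
preserved by preimages. Part (c) then follows formally, since `R ↦ min R[·]` and `f ↦ R_f` are
mutually inverse.
-/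

namespace GenPriestley

/-! ### The elements of `Y_L` in an algebraic frame -/

section Pseudoprimes

variable {L : Type u}

theorem WayBelow.le [CompleteLattice L] {a b : L} (h : WayBelow a b) : a ≤ b := by
  obtain ⟨T, hT, _, ha⟩ := h {b} sSup_singleton.ge
  exact ha.trans ((sSup_le_sSup hT).trans_eq sSup_singleton)

theorem mem_pseudoprimesTop_iff_wayBelow [CompleteLattice L] {p : L} :
    p ∈ pseudoprimesTop L ↔
      ∀ S : Set L, S.Finite → S.Nonempty → WayBelow (sInf S) p → ∃ a ∈ S, a ≤ p := by
  constructor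
  · rintro (hp | rfl) S hS ⟨a, ha⟩ h
    · exact hp.2 S hS h
    · exact ⟨a, ha, le_top⟩
  · intro h
    refine or_iff_not_imp_right.2 fun hp => ⟨hp, fun S hS hSp => ?_⟩
    rcases S.eq_empty_or_nonempty with rfl | hne
    · exact absurd (top_le_iff.1 (sInf_empty.ge.trans hSp.le)) hp
    · exact h S hS hne hSp

theorem mem_pseudoprimesTop_iff_isCompactElement [Order.Frame L] [IsCompactlyGenerated L] {p : L} :
    p ∈ pseudoprimesTop L ↔
      ∀ S : Set L, S.Finite → S.Nonempty → (∀ k ∈ S, IsCompactElement k) →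
        IsCompactElement (sInf S) → sInf S ≤ p → ∃ k ∈ S, k ≤ p := by
  rw [mem_pseudoprimesTop_iff_wayBelow]
  constructor
  · exact fun h S hS hne _ hc hSp => h S hS hne (wayBelow_iff.2 ⟨_, hc, le_rfl, hSp⟩)
  · intro h S hS hne hSp
    obtain ⟨t, ht, hSt, htp⟩ := wayBelow_iff.1 hSp
    lift S to Finset L using hS
    by_contra! hn
    choose! k hk hka hkp using fun a (ha : a ∈ S) => exists_compact (hn a ha)
    -- Joining with `t` makes the meet equal to `t`, hence compact.
    have hmeet : sInf ((fun a => k a ⊔ t) '' (S : Set L)) = t := by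
      rw [← Finset.inf_eq_sInf_image, ← Finset.inf_sup_distrib_right, sup_eq_right]
      exact (le_sInf fun a ha => (Finset.inf_le ha).trans (hka a ha)).trans hSt
    have hcompact : ∀ c ∈ (fun a => k a ⊔ t) '' (S : Set L), IsCompactElement c := by
      rintro _ ⟨a, ha, rfl⟩
      simpa only [sSup_pair] using compact_sSup (T := {k a, t}) (by simp) (by simp [hk a ha, ht])
    obtain ⟨_, ⟨a, ha, rfl⟩, hap⟩ := h _ (S.finite_toSet.image _) (hne.image _) hcompact
      (hmeet.symm ▸ ht) (hmeet.trans_le htp)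
    exact hkp a ha (le_sup_left.trans hap)

end Pseudoprimes

/-! ### The isomorphism `η` -/

theorem isCompactElement_map_orderIso {A B : Type*} [PartialOrder A] [PartialOrder B] (e : A ≃o B)
    {k : A} (hk : IsCompactElement k) : IsCompactElement (e k) := by
  intro s u hs hdir hu hku
  have hdir' : DirectedOn (· ≤ ·) (e.symm '' s) :=
    directedOn_image.2 (hdir.mono' fun _ _ _ _ h => e.symm.monotone h)
  obtain ⟨_, ⟨x, hx, rfl⟩, hkx⟩ := hk (e.symm '' s) (e.symm u) (hs.image _) hdir'
    (e.symm.isLUB_image'.2 hu) (e.le_symm_apply.2 hku)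
  exact ⟨x, hx, e.le_symm_apply.1 hkx⟩

section OrderIso

variable {L M : AlgFrmJ.{u}}

/-- An order isomorphism of algebraic frames as a morphism of `AlgFrm_J`. -/
def JMor.ofOrderIso (e : L ≃o M) : JMor L M where
  toFun := e
  map_sSup S := by rw [e.map_sSup, sSup_image]
  map_compact _ := isCompactElement_map_orderIso e

theorem preservesCompactMeets_ofOrderIso (e : L ≃o M) :
    preservesCompactMeets (X := L) (Y := M) (JMor.ofOrderIso e) :=
  fun S _ _ _ _ => (e.map_sInf S).trans sInf_image.symm

/-- An order isomorphism of algebraic frames as an isomorphism in `AlgFrm_J`. -/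
def AlgFrmJ.isoOfOrderIso (e : L ≃o M) : L ≅ M where
  hom := JMor.ofOrderIso e
  inv := JMor.ofOrderIso e.symm
  hom_inv_id := JMor.ext (funext e.symm_apply_apply)
  inv_hom_id := JMor.ext (funext e.apply_symm_apply)

end OrderIso

section Eta

variable {L : AlgFrmJ.{u}}

theorem up_subset_up {a b : L} : up b ⊆ up a ↔ a ≤ b := by
  refine ⟨fun h => ?_, fun h p hp => le_trans h hp⟩
  by_contra hn
  obtain ⟨p, _, hbp, hap⟩ := exists_prime' hn
  exact hap (h hbp)

theorem up_sSup (S : Set L) : up (sSup S) = ⋂₀ (up '' S) := by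
  ext p
  rw [Set.mem_sInter, Set.forall_mem_image]
  exact sSup_le_iff

theorem adm_up {k : L} (hk : IsCompactElement k) : (YObj L).Adm (up k) :=
  (admissible_Y_iff _).2 ⟨k, hk, rfl⟩

theorem admClosed_up (a : L) : (YObj L).AdmClosed (up a) := by
  rw [← sSup_compact_le_eq a, up_sSup]
  refine admClosed_sInter (X := YObj L) _ ?_
  rintro _ ⟨k, hk, rfl⟩
  exact (adm_up hk.1).admClosed

theorem exists_up_eq {C : Set (YSp L)} (hC : (YObj L).AdmClosed C) : ∃ a : L, up a = C := by
  refine ⟨sSup {k | IsCompactElement k ∧ C ⊆ up k}, ?_⟩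
  rw [up_sSup]
  apply Set.Subset.antisymm
  · intro p hp
    by_contra hpC
    obtain ⟨U, hU, hCU, hpU⟩ := PGPS.separation hC hpC
    obtain ⟨k, hk, rfl⟩ := (admissible_Y_iff _).1 hU
    exact hpU (hp _ ⟨k, ⟨hk, hCU⟩, rfl⟩)
  · exact Set.subset_sInter (Set.forall_mem_image.2 fun k hk => hk.2)

variable (L) in
/-- The map `η_L`, `a ↦ ↑a ∩ Y_L`, as an order isomorphism. -/
noncomputable def etaOrderIso : L ≃o Va (YObj L) :=
  OrderIso.ofSurjective (OrderEmbedding.ofMapLEIff (fun a => ⟨up a, admClosed_up a⟩)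
    fun _ _ => up_subset_up) fun C => (exists_up_eq C.property).imp fun _ => Va.ext

end Eta

/-- The natural isomorphism `η` on `AlgFrm_J`. -/
noncomputable def eta : 𝟭 AlgFrmJ.{u} ≅ functorY ⋙ functorV :=
  NatIso.ofComponents (fun L => AlgFrmJ.isoOfOrderIso (M := ⟨Va (YObj L)⟩) (etaOrderIso L))
    fun α => JMor.ext (funext fun a => Va.ext (box_YRel α a).symm)

/-! ### The isomorphism `Υ` -/

section Principal

variable {X : PGPS.{u}}

theorem PGPS.Ici_eq_sInter (x : X) : Set.Ici x = ⋂₀ {U | X.Adm U ∧ x ∈ U} := by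
  ext y
  exact (X.le_iff x y).trans (forall_congr' fun _ => and_imp.symm)

theorem PGPS.admClosed_Ici (x : X) : X.AdmClosed (Set.Ici x) :=
  X.Ici_eq_sInter x ▸ admClosed_sInter _ fun _ hU => hU.1.admClosed

/-- The principal upset `↑x` as an element of `𝒱ᵃ(X)`. -/
def Va.principal (x : X) : Va X := ⟨Set.Ici x, PGPS.admClosed_Ici x⟩

namespace Va

theorem le_principal_iff {C : Va X} {x : X} : C ≤ principal x ↔ x ∈ C.val :=
  ⟨fun h => h le_rfl, fun h _ hy => C.property.2.1 hy h⟩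

theorem principal_le_principal {x y : X} : principal x ≤ principal y ↔ x ≤ y :=
  le_principal_iff

theorem m_mem (C : Va X) : X.m ∈ C.val := by
  by_contra h
  obtain ⟨y, hy, _, hmy⟩ := ((X.admClosed_iff _).1 C.property).2.2 _ h
  exact X.X₀_subset hy (le_antisymm (X.le_m y) hmy)

theorem meetPrime_principal {x : X} (hx : x ∈ X.X₀) : MeetPrime (principal x) := by
  refine ⟨fun h => ?_, fun A B h => ?_⟩
  · have hmx : X.m ≤ x := principal_le_principal.1 (le_top.trans h.ge)
    exact X.X₀_subset hx (le_antisymm (X.le_m x) hmx)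
  · simp only [le_principal_iff] at h ⊢
    exact mem_inf hx h

theorem exists_mem_of_mem_sInf {S : Set (Va X)} (hS : S.Finite) {x : X} (hx : x ∈ X.X₀)
    (h : x ∈ (sInf S).val) : ∃ C ∈ S, x ∈ C.val := by
  simpa only [le_principal_iff] using (meetPrime_principal hx).sInf_le hS (le_principal_iff.2 h)

theorem val_sInf_of_isCompactElement {S : Set (Va X)} (hS : S.Finite) (hne : S.Nonempty)
    (hc : IsCompactElement (sInf S)) : (sInf S).val = ⋃ C ∈ S, C.val := by
  apply Set.Subset.antisymm
  · intro x hx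
    by_cases hxm : x = X.m
    · obtain ⟨C, hC⟩ := hne
      exact Set.mem_biUnion hC (hxm ▸ C.m_mem)
    · have hX₀ : (sInf S).val ∩ X.X₀ ⊆ ⋃ C ∈ S, C.val := fun y hy =>
        Set.mem_iUnion₂.2 (by simpa using exists_mem_of_mem_sInf hS hy.2 hy.1)
      have hclosed : IsClosed (⋃ C ∈ S, C.val) := hS.isClosed_biUnion fun C _ => C.property.1
      have hopen : IsOpen (sInf S).val := ((Va.compact_iff _).1 hc).1.isOpen
      exact closure_minimal hX₀ hclosed (hopen.inter_closure ⟨hx, X.dense hxm⟩)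
  · exact Set.iUnion₂_subset fun C hC => (sInf_le hC : sInf S ≤ C)

theorem eq_sInf_of_val_eq_biUnion {S : Set (Va X)} {C : Va X} (h : C.val = ⋃ D ∈ S, D.val) :
    C = sInf S := by
  refine le_antisymm (le_sInf fun D hD => ?_) fun x hx => ?_
  · exact (Set.subset_biUnion_of_mem (u := Va.val) hD).trans h.ge
  · obtain ⟨D, hD, hxD⟩ := Set.mem_iUnion₂.1 (h.subset hx)
    exact (sInf_le hD : sInf S ≤ D) hxD

theorem principal_mem_pseudoprimesTop (x : X) : principal x ∈ pseudoprimesTop (Va X) := by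
  refine mem_pseudoprimesTop_iff_isCompactElement.2 fun S hS hne _ hc h => ?_
  rw [le_principal_iff, val_sInf_of_isCompactElement hS hne hc] at h
  simpa only [le_principal_iff, Set.mem_iUnion, exists_prop] using h

end Va

end Principal

section Upsilon

variable {X : PGPS.{u}}

/-- The map `x ↦ ↑x` from `X` to `Y_{𝒱ᵃ(X)}`, which induces `Υ_X`. -/
def upsilonFun (x : X) : YSp ⟨Va X⟩ := ⟨Va.principal x, Va.principal_mem_pseudoprimesTop x⟩

theorem upsilonFun_preimage_up (C : Va X) : upsilonFun ⁻¹' up (L := ⟨Va X⟩) C = C.val :=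
  Set.ext fun _ => Va.le_principal_iff

theorem continuous_upsilonFun : Continuous (upsilonFun (X := X)) := by
  have htop := YSp.topology_eq ⟨Va X⟩
  refine (congrArg (@Continuous _ _ _ · upsilonFun) htop).mpr (continuous_generateFrom_iff.2 ?_)
  have hclopen {K : Va X} (hK : IsCompactElement K) :
      IsClopen (upsilonFun ⁻¹' up (L := ⟨Va X⟩) K) := by
    rw [upsilonFun_preimage_up]
    exact ((Va.compact_iff K).1 hK).1
  rintro _ (⟨K, hK, rfl⟩ | ⟨K, hK, rfl⟩)
  · exact (hclopen hK).isOpen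
  · exact (hclopen hK).compl.isOpen

theorem denseRange_upsilonFun : DenseRange (upsilonFun (X := X)) := by
  refine dense_iff_inter_open.2 fun W hW ⟨q, hq⟩ => ?_
  obtain ⟨K, hK, hKq, T, hT, hTq, hKT⟩ := nhds_basis hW hq
  suffices ∃ x : X, x ∈ K.val ∧ ∀ D ∈ T, x ∉ D.val by
    obtain ⟨x, hxK, hxT⟩ := this
    exact ⟨upsilonFun x, hKT _ (Va.le_principal_iff.2 hxK) fun D hD hDx =>
      hxT D hD (Va.le_principal_iff.1 hDx), x, rfl⟩
  by_contra! hcover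
  have hTK : sInf T ≤ K := fun x hx => by
    obtain ⟨D, hD, hxD⟩ := hcover x hx
    exact (sInf_le hD : sInf T ≤ D) hxD
  have hne : T.Nonempty := (hcover _ K.m_mem).imp fun _ h => h.1
  obtain ⟨D, hD, hDq⟩ := mem_pseudoprimesTop_iff_wayBelow.1 q.2 T hT hne
    (wayBelow_iff.2 ⟨K, hK, hTK, hKq⟩)
  exact hTq D hD hDq

theorem surjective_upsilonFun : Function.Surjective (upsilonFun (X := X)) := by
  rw [← Set.range_eq_univ, ← denseRange_upsilonFun.closure_range]
  exact (isCompact_range continuous_upsilonFun).isClosed.closure_eq.symm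

variable (X) in
/-- The map `x ↦ ↑x` as an order isomorphism. -/
noncomputable def upsilonOrderIso : X ≃o YObj ⟨Va X⟩ :=
  OrderIso.ofSurjective (OrderEmbedding.ofMapLEIff (upsilonFun (X := X))
    fun _ _ => Va.principal_le_principal) surjective_upsilonFun

theorem adm_iff_adm_preimage_upsilonFun {U : Set (YSp ⟨Va X⟩)} :
    (YObj ⟨Va X⟩).Adm U ↔ X.Adm (upsilonFun ⁻¹' U) := by
  constructor
  · intro hU
    obtain ⟨K, hK, rfl⟩ := (admissible_Y_iff U).1 hU
    rw [upsilonFun_preimage_up]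
    exact (Va.compact_iff K).1 hK
  · intro hU
    have hup : up (L := ⟨Va X⟩) ⟨_, hU.admClosed⟩ = U :=
      surjective_upsilonFun.preimage_injective (upsilonFun_preimage_up _)
    exact hup ▸ adm_up (L := ⟨Va X⟩) ((Va.compact_iff _).2 hU)

/-- An order isomorphism that matches the admissible clopen upsets, as an isomorphism in
`PGPS_S`. -/
def PGPSS.isoOfOrderIso {X Y : PGPSS.{u}} (e : X.toPGPS ≃o Y.toPGPS)
    (h : ∀ U, Y.toPGPS.Adm U ↔ X.toPGPS.Adm (e ⁻¹' U)) : X ≅ Y where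
  hom := ⟨e, e.monotone, fun U => (h U).1⟩
  inv := ⟨e.symm, e.symm.monotone, fun U hU =>
    (h _).2 ((e.toEquiv.preimage_symm_preimage U).symm ▸ hU)⟩
  hom_inv_id := StrongMor.ext (funext e.symm_apply_apply)
  inv_hom_id := StrongMor.ext (funext e.apply_symm_apply)

end Upsilon

/-- The isomorphism `x ↦ ↑x` of `PGPS_S`. -/
noncomputable def upsilonIsoS (X : PGPSS.{u}) : X ≅ ⟨YObj ⟨Va X.toPGPS⟩⟩ :=
  PGPSS.isoOfOrderIso (Y := ⟨YObj ⟨Va X.toPGPS⟩⟩) (upsilonOrderIso X.toPGPS)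
    fun _ => adm_iff_adm_preimage_upsilonFun

/-- The isomorphism `Υ_X` of `PGPS_F`. -/
noncomputable def upsilonIsoF (X : PGPSF.{u}) : X ≅ ⟨YObj ⟨Va X.obj⟩⟩ :=
  ofStrong.mapIso (upsilonIsoS ⟨X.obj⟩)

/-- The isomorphism `Υ_X` of `PGPS`. -/
noncomputable def upsilonIso (X : PGPS.{u}) : X ≅ YObj ⟨Va X⟩ :=
  (wideSubcategoryInclusion functional).mapIso (upsilonIsoF ⟨X⟩)

theorem box_upsilonIso_up {X : PGPS.{u}} (C : Va X) :
    box (GPMor.rel (upsilonIso X).hom) (up (L := ⟨Va X⟩) C) = C.val :=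
  (box_of_fun (Y := YObj ⟨Va X⟩) upsilonFun (isUpperSet_up (L := ⟨Va X⟩) C)).trans
    (upsilonFun_preimage_up C)

theorem upsilonIso_naturality {X Z : PGPS.{u}} (R : X ⟶ Z) :
    (upsilonIso X).hom ≫ (functorY.map (functorV.map R.op)).unop = R ≫ (upsilonIso Z).hom := by
  refine GPMor.ext_box fun U hU => ?_
  obtain ⟨C, _, rfl⟩ := (admissible_Y_iff U).1 hU
  calc
    _ = box (GPMor.rel (upsilonIso X).hom) (box (YRel (functorV.map R.op)) (up C)) :=
      GPMor.box_comp (upsilonIso X).hom (YMap (functorV.map R.op)) hU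
    _ = box R.rel C.val := by rw [box_YRel]; exact box_upsilonIso_up (Va.box R C)
    _ = box R.rel (box (GPMor.rel (upsilonIso Z).hom) (up (L := ⟨Va Z⟩) C)) := by
      rw [box_upsilonIso_up]
    _ = _ := (GPMor.box_comp R (upsilonIso Z).hom hU).symm

/-- The natural isomorphism `Υ` on `PGPS`. -/
noncomputable def upsilon : functorV ⋙ functorY ≅ 𝟭 PGPS.{u}ᵒᵖ :=
  NatIso.ofComponents (fun X => (upsilonIso X.unop).op)
    fun R => Quiver.Hom.unop_inj (upsilonIso_naturality R.unop)

/-! ### Functional morphisms -/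

theorem rightAdjoint_mem_pseudoprimesTop {L M : AlgFrmJ.{u}} {α : L ⟶ M}
    (hα : preservesCompactMeets α) {p : M} (hp : p ∈ pseudoprimesTop M) :
    JMor.rightAdjoint α p ∈ pseudoprimesTop L := by
  refine mem_pseudoprimesTop_iff_isCompactElement.2 fun S hS hne hk hc hSp => ?_
  have hmap := hα S hS hne hk hc
  have hmem := mem_pseudoprimesTop_iff_isCompactElement.1 hp (JMor.toFun α '' S) (hS.image _)
    (hne.image _) (Set.forall_mem_image.2 fun k hkS => α.map_compact k (hk k hkS))
    (hmap ▸ α.map_compact _ hc) (hmap ▸ (α.gc _ _).2 hSp)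
  simpa only [Set.exists_mem_image, α.gc _ _] using hmem

/-- The restriction `Y_M → Y_L` of the right adjoint of an `AlgFrm_S`-morphism `L → M`. -/
def rightAdjointY {L M : AlgFrmJ.{u}} {α : L ⟶ M} (hα : preservesCompactMeets α) (p : YSp M) :
    YSp L :=
  ⟨JMor.rightAdjoint α p.val, rightAdjoint_mem_pseudoprimesTop hα p.2⟩

theorem functional_functorY_map (L M : AlgFrmJ.{u}) (α : L ⟶ M) (hα : preservesCompactMeets α) :
    functional (functorY.map α).unop :=
  fun p => ⟨rightAdjointY hα p, le_refl (JMor.rightAdjoint α p.val), fun _ h => h⟩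

theorem preservesCompactMeets_functorV_map (X Y : PGPS.{u}) (R : X ⟶ Y) (hR : functional R) :
    preservesCompactMeets (functorV.map R.op) := by
  intro S hS hne _ hc
  have hbox (C : Va Y) : (Va.box R C).val = leastFun R hR ⁻¹' C.val :=
    box_leastFun R hR C.property.2.1
  apply Va.eq_sInf_of_val_eq_biUnion
  calc
    (Va.box R (sInf S)).val = leastFun R hR ⁻¹' ⋃ C ∈ S, C.val := by
      rw [hbox, Va.val_sInf_of_isCompactElement hS hne hc]
    _ = ⋃ D ∈ Va.box R '' S, D.val := by
      simp only [Set.preimage_iUnion₂, Set.biUnion_image, hbox]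

/-- The restriction of `η` to `AlgFrm_S`. -/
noncomputable def etaF : 𝟭 AlgFrmS.{u} ≅
    restrictY functional_functorY_map ⋙ restrictV preservesCompactMeets_functorV_map :=
  NatIso.ofComponents
    (fun L => WideSubcategory.isoMk (eta.app L.obj)
      (preservesCompactMeets_ofOrderIso (M := ⟨Va (YObj L.obj)⟩) (etaOrderIso L.obj))
      (preservesCompactMeets_ofOrderIso (L := ⟨Va (YObj L.obj)⟩) (etaOrderIso L.obj).symm))
    fun α => WideSubcategory.hom_ext _ (eta.hom.naturality α.hom)

/-- The restriction of `Υ` to `PGPS_F`. -/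
noncomputable def upsilonF :
    restrictV preservesCompactMeets_functorV_map ⋙ restrictY functional_functorY_map ≅
      𝟭 PGPSF.{u}ᵒᵖ :=
  NatIso.ofComponents (fun X => (upsilonIsoF X.unop).op) fun R =>
    Quiver.Hom.unop_inj (WideSubcategory.hom_ext _ (upsilonIso_naturality R.unop.hom))

/-! ### Strong Priestley morphisms -/

theorem ofStrong_map_toStrong_map {X Y : PGPSF.{u}} (R : X ⟶ Y) :
    ofStrong.map (toStrong.map R) = R :=
  WideSubcategory.hom_ext _ (GPMor.ext (funext₂ fun x y =>
    propext (rel_iff_leastFun_le R.hom R.property x y).symm))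

theorem toStrong_map_ofStrong_map {X Y : PGPSS.{u}} (f : X ⟶ Y) :
    toStrong.map (ofStrong.map f) = f :=
  StrongMor.ext (funext fun x => leastFun_eq _ _ x (StrongMor.toFun f x) fun _ => Iff.rfl)

/-- The natural isomorphism `η` for the duality of `AlgFrm_S` and `PGPS_S`. -/
noncomputable def etaS : 𝟭 AlgFrmS.{u} ≅
    strongY functional_functorY_map ⋙ strongV preservesCompactMeets_functorV_map :=
  NatIso.ofComponents (fun L => etaF.app L) fun {L M} α => by
    have hmap : (strongY functional_functorY_map ⋙
          strongV preservesCompactMeets_functorV_map).map α =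
        (restrictY functional_functorY_map ⋙
          restrictV preservesCompactMeets_functorV_map).map α :=
      congrArg (fun R : (⟨YObj M.obj⟩ : PGPSF) ⟶ ⟨YObj L.obj⟩ =>
        (restrictV preservesCompactMeets_functorV_map).map R.op)
        (ofStrong_map_toStrong_map ((restrictY functional_functorY_map).map α).unop)
    rw [hmap]
    exact etaF.hom.naturality α

/-- The natural isomorphism `x ↦ ↑x` for the duality of `AlgFrm_S` and `PGPS_S`. -/
noncomputable def upsilonS :
    strongV preservesCompactMeets_functorV_map ⋙ strongY functional_functorY_map ≅
      𝟭 PGPSS.{u}ᵒᵖ :=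
  NatIso.ofComponents (fun X => (upsilonIsoS X.unop).op) fun {X Y} f => by
    have hmap {Z W : PGPSS.{u}} (g : Z ⟶ W) : toStrong.op.map (ofStrong.map g).op = g.op :=
      congrArg Quiver.Hom.op (toStrong_map_ofStrong_map g)
    have hnat := congrArg toStrong.op.map (upsilonF.hom.naturality (ofStrong.op.map f))
    rw [Functor.map_comp, Functor.map_comp] at hnat
    calc
      _ = _ ≫ toStrong.op.map (ofStrong.map (upsilonIsoS Y.unop).hom).op :=
        congrArg (_ ≫ ·) (hmap (upsilonIsoS Y.unop).hom).symm
      _ = toStrong.op.map (ofStrong.map (upsilonIsoS X.unop).hom).op ≫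
          toStrong.op.map (ofStrong.map f.unop).op := hnat
      _ = _ := congrArg₂ (· ≫ ·) (hmap _) (hmap _)

theorem strongY_map_apply {L M : AlgFrmS.{u}} (α : L ⟶ M) (p : YSp M.obj) :
    StrongMor.toFun ((strongY functional_functorY_map).map α).unop p =
      rightAdjointY α.property p :=
  leastFun_eq (functorY.map α.hom).unop _ p (rightAdjointY α.property p) fun _ => Iff.rfl

theorem strongV_map_val {X Y : PGPSS.{u}} (f : X ⟶ Y) (C : Va Y.toPGPS) :
    (JMor.toFun ((strongV preservesCompactMeets_functorV_map).map f.op).hom C : Va X.toPGPS).val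
      = StrongMor.toFun f ⁻¹' C.val :=
  box_of_fun (StrongMor.toFun f) C.property.2.1

end GenPriestley

theorem mainTheorem4 :
    -- `𝒴` and `𝒱ᵃ` form a dual equivalence of `AlgFrm_J` and `PGPS`, with units `η` and `Υ`
    ∃ (η : 𝟭 AlgFrmJ.{u} ≅ functorY ⋙ functorV) (Υ : functorV ⋙ functorY ≅ 𝟭 PGPS.{u}ᵒᵖ),
      (∀ (L : AlgFrmJ.{u}) (a : L), (JMor.toFun (η.hom.app L) a).val = {p : YSp L | a ≤ p.val}) ∧
      (∀ (X : PGPS.{u}) (x : X) (C : YSp ⟨Va X⟩),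
        GPMor.rel (Υ.hom.app (op X)).unop x C ↔ C.val.val ⊆ Set.Ici x) ∧
    -- `𝒴`, `𝒱ᵃ`, `η` and `Υ` restrict to a dual equivalence of `AlgFrm_S` and `PGPS_F`
    ∃ (hY : ∀ (L M : AlgFrmJ.{u}) (α : L ⟶ M), preservesCompactMeets α →
        functional (functorY.map α).unop)
      (hV : ∀ (X Y : PGPS.{u}) (R : X ⟶ Y), functional R →
        preservesCompactMeets (functorV.map R.op)),
      (∃ (ηF : 𝟭 AlgFrmS.{u} ≅ restrictY hY ⋙ restrictV hV)
        (ΥF : restrictV hV ⋙ restrictY hY ≅ 𝟭 PGPSF.{u}ᵒᵖ),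
        (∀ L : AlgFrmS.{u}, (ηF.hom.app L).hom = η.hom.app L.obj) ∧
        (∀ X : PGPSF.{u}, (ΥF.hom.app (op X)).unop.hom = (Υ.hom.app (op X.obj)).unop)) ∧
    -- passing to strong Priestley morphisms they yield a dual equivalence of `AlgFrm_S` and `PGPS_S`
      (∃ (ηS : 𝟭 AlgFrmS.{u} ≅ strongY hY ⋙ strongV hV)
        (ΥS : strongV hV ⋙ strongY hY ≅ 𝟭 PGPSS.{u}ᵒᵖ),
        (∀ L : AlgFrmS.{u}, (ηS.hom.app L).hom = η.hom.app L.obj) ∧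
        (∀ (X : PGPSS.{u}) (x : X.toPGPS),
          ((StrongMor.toFun (ΥS.hom.app (op X)).unop x : YSp ⟨Va X.toPGPS⟩)).val.val
            = Set.Ici x)) ∧
    -- this duality sends `α` to the restriction of its right adjoint, and `f` to `f⁻¹`
      (∀ (L M : AlgFrmS.{u}) (α : L ⟶ M) (p : YSp M.obj),
        (StrongMor.toFun ((strongY hY).map α).unop p : YSp L.obj).val
          = JMor.rightAdjoint α.hom p.val) ∧
      (∀ (X Y : PGPSS.{u}) (f : X ⟶ Y) (C : Va Y.toPGPS),
        (JMor.toFun ((strongV hV).map f.op).hom C : Va X.toPGPS).val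
          = StrongMor.toFun f ⁻¹' C.val) := by
  refine ⟨eta, upsilon, fun L a => rfl, fun X x C => Iff.rfl, functional_functorY_map,
    preservesCompactMeets_functorV_map, ?restricted, ?strong, ?rightAdjoint, ?preimage⟩
  case restricted => exact ⟨etaF, upsilonF, fun L => rfl, fun X => rfl⟩
  case strong => exact ⟨etaS, upsilonS, fun L => rfl, fun X x => rfl⟩
  case rightAdjoint => exact fun L M α p => congrArg Subtype.val (strongY_map_apply α p)
  case preimage => exact fun X Y f C => strongV_map_val f C
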